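/- Let $C$ be a finite nonempty set of alternatives and fix a dispersion $\varphi\in(0,1)$. Let $\mathcal B(C)$ be the set of all irreflexive, antisymmetric and total (possibly cyclic) binary relations on $C$, let $\mathcal L(C)\subseteq\mathcal B(C)$ be the set of linear orders, and for $V,W\in\mathcal B(C)$ let $\mathrm{Kendall}(V,W)$ be the number of pairs of alternatives that $V$ and $W$ order differently. In the Condorcet model the parameter is $W\in\mathcal B(C)$, and a profile $P=(V_1,\dots,V_n)$ has likelihood $$\Pr(P\mid W)=\prod_{i=1}^n \frac1Z\,\varphi^{\mathrm{Kendall}(V_i,W)},\qquad Z=\sum_{V\in\mathcal B(C)}\varphi^{\mathrm{Kendall}(V,W)}.$$ For a nonempty set $D\subseteq C$ let $L_{top}(W,D)$ be the fraction of the $c\in D$ that are not ranked above all other alternatives in $W$, and let the Bayesian risk $R_B(P,D)=\sum_{W\in\mathcal B(C)}\Pr(W\mid P)\,L_{top}(W,D)$ be the expected loss under the posterior distribution obtained from the uniform prior on $\mathcal B(C)$ and the likelihood above. Let $f_B^2$ be a Bayesian estimator, that is, any rule such that for every profile $P$ the nonempty set $f_B^2(P)\subseteq C$ minimizes $R_B(P,\cdot)$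 among all nonempty subsets of $C$. For a profile $P$ let $w_P(a,b)$ be the number of votes in $P$ that prefer $a$ to $b$ minus the number that prefer $b$ to $a$, let $s(c,P)=\sum_{b:\,w_P(b,c)>0}w_P(b,c)$, and let $g(P)=\arg\min_{c\in C}s(c,P)$ be the set of all minimizers. **Theorem.** For every ground truth $W\in\mathcal B(C)$, every $\varphi\in(0,1)$ and every Bayesian estimator $f_B^2$ as above, if $P_n$ consists of $n$ votes drawn i.i.d. from $\mathcal L(C)$, where $V\in\mathcal L(C)$ has probability proportional to $\varphi^{\mathrm{Kendall}(V,W)}$, then $$\lim_{n\to\infty}\Pr\big(f_B^2(P_n)=g(P_n)\big)=1 .$$ The same holds if the votes are instead drawn i.i.d. from all of $\mathcal B(C)$, where $V\in\mathcal B(C)$ has probability $\frac1Z\varphi^{\mathrm{Kendall}(V,W)}$ (for votes restricted to $\mathcal L(C)$, $f_B^2$ only needs to minimize the risk on profiles of linear orders). -/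

import Mathlib

open MeasureTheory ProbabilityTheory Filter Topology

namespace SocialChoice

/-- The set `B(C)` of all irreflexive, antisymmetric and total binary relations over `C`;
`W.rel a b` reads "`a` is preferred to `b` in `W`". Cycles are allowed. -/
@[ext]
structure BRel (C : Type*) where
  rel : C → C → Prop
  irrefl : ∀ a, ¬ rel a a
  antisymm : ∀ a b, rel a b → rel b a → a = b
  total : ∀ a b, a ≠ b → rel a b ∨ rel b a

instance (C : Type*) [Finite C] : Finite (BRel C) :=
  Finite.of_injective BRel.rel (fun _ _ h => BRel.ext h)

noncomputable instance (C : Type*) [Finite C] : Fintype (BRel C) := Fintype.ofFinite _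

instance (C : Type*) : MeasurableSpace (BRel C) := ⊤

instance (C : Type*) : DiscreteMeasurableSpace (BRel C) := ⟨fun _ => trivial⟩

/-- The set `L(C)` of linear orders over `C`, as the subset of transitive members of `B(C)`. -/
def linearOrders (C : Type*) : Set (BRel C) :=
  {V | ∀ a b c, V.rel a b → V.rel b c → V.rel a c}

/-- Kendall-tau distance: the number of pairwise disagreements. Each pair of alternatives ordered
differently in `V` and `W` is counted once, namely in the orientation it has in `V`. -/
noncomputable def kendall {C : Type*} (V W : BRel C) : ℕ :=
  Set.ncard {p : C × C | V.rel p.1 p.2 ∧ W.rel p.2 p.1}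

/-- A profile of `n` votes. -/
abbrev Profile (C : Type*) (n : ℕ) : Type _ := Fin n → BRel C

/-- The normalization factor `Z`, a sum over `B(C)`. -/
noncomputable def normFactor {C : Type*} [Fintype C] (φ : ℝ) (W : BRel C) : ℝ :=
  ∑ V : BRel C, φ ^ kendall V W

/-- `Pr(V | W)` for a single vote `V` in the Condorcet model with dispersion `φ`. -/
noncomputable def voteProb {C : Type*} [Fintype C] (φ : ℝ) (W V : BRel C) : ℝ :=
  1 / normFactor φ W * φ ^ kendall V W

/-- `Pr(P | W)` for a profile `P` in the Condorcet model with dispersion `φ`. -/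
noncomputable def likelihood {C : Type*} [Fintype C] (φ : ℝ) {n : ℕ} (P : Profile C n)
    (W : BRel C) : ℝ :=
  ∏ i, voteProb φ W (P i)

/-- The uniform prior over the parameter space `B(C)`. -/
noncomputable def uniformPrior (C : Type*) [Fintype C] (_W : BRel C) : ℝ :=
  1 / (Fintype.card (BRel C) : ℝ)

/-- The posterior probability of the parameter `W` given the profile `P`, by Bayes' rule. -/
noncomputable def posterior {C : Type*} [Fintype C] (φ : ℝ) {n : ℕ} (P : Profile C n)
    (W : BRel C) : ℝ :=
  likelihood φ P W * uniformPrior C W / ∑ W' : BRel C, likelihood φ P W' * uniformPrior C W'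

open scoped Classical in
/-- The loss of a single alternative: `0` if it beats all others in `W`, and `1` otherwise. -/
noncomputable def lossTopAlt {C : Type*} (W : BRel C) (c : C) : ℝ :=
  if ∀ b, b ≠ c → W.rel c b then 0 else 1

/-- The loss of a set of alternatives: the average loss of its members. -/
noncomputable def lossTop {C : Type*} (W : BRel C) (D : Finset C) : ℝ :=
  (∑ c ∈ D, lossTopAlt W c) / (D.card : ℝ)

/-- The Bayesian risk of the decision `D` given the profile `P`: its expected loss under the
posterior distribution. -/
noncomputable def bayesRisk {C : Type*} [Fintype C] (φ : ℝ) {n : ℕ} (P : Profile C n)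
    (D : Finset C) : ℝ :=
  ∑ W : BRel C, posterior φ P W * lossTop W D

/-- `f` is a (deterministic) Bayesian estimator for profiles of votes from `S`, with decision space
the nonempty sets of alternatives: on every such profile it takes a decision of minimum risk. -/
def IsBayesianEstimator {C : Type*} [Fintype C] (φ : ℝ) (S : Set (BRel C))
    (f : (n : ℕ) → Profile C n → Finset C) : Prop :=
  ∀ (n : ℕ) (P : Profile C n), (∀ i, P i ∈ S) →
    (f n P).Nonempty ∧ ∀ D : Finset C, D.Nonempty → bayesRisk φ P (f n P) ≤ bayesRisk φ P D

/-- The weight `w_P(a, b)` in the weighted majority graph of `P`. -/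
noncomputable def wmg {C : Type*} {n : ℕ} (P : Profile C n) (a b : C) : ℤ :=
  (Set.ncard {i : Fin n | (P i).rel a b} : ℤ) - (Set.ncard {i : Fin n | (P i).rel b a} : ℤ)

/-- `s(c, P)`: the total positive weight on the edges into `c` in the weighted majority graph. -/
noncomputable def inWeight {C : Type*} [Fintype C] {n : ℕ} (c : C) (P : Profile C n) : ℤ :=
  ∑ b : C with 0 < wmg P b c, wmg P b c

open scoped Classical in
/-- The rule `g`: the set of all alternatives that minimize `s(c, P)`. -/
noncomputable def ruleG {C : Type*} [Fintype C] {n : ℕ} (P : Profile C n) : Finset C :=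
  {c : C | ∀ b : C, inWeight c P ≤ inWeight b P}

/-- The distribution over `B(C)` with point masses `Pr(V | W)`. -/
noncomputable def condorcetMeasure {C : Type*} [Fintype C] (φ : ℝ) (W : BRel C) :
    Measure (BRel C) :=
  ∑ V : BRel C, ENNReal.ofReal (voteProb φ W V) • Measure.dirac V

/-- The law of a vote when votes range over `S`: a vote `V` in `S` has probability proportional to
`φ ^ kendall V W`, that is, `condorcetMeasure φ W` is conditioned on `S`. -/
noncomputable def voteLaw {C : Type*} [Fintype C] (φ : ℝ) (W : BRel C) (S : Set (BRel C)) :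
    Measure (BRel C) :=
  (condorcetMeasure φ W)[|S]

/-- The law of a profile of `n` votes drawn i.i.d. from `voteLaw φ W S`. -/
noncomputable def profileLaw {C : Type*} [Fintype C] (φ : ℝ) (W : BRel C) (S : Set (BRel C))
    (n : ℕ) : Measure (Profile C n) :=
  Measure.pi fun _ : Fin n => voteLaw φ W S

end SocialChoice

/-!
With the uniform prior on `B(C)`, the posterior probability of `W'` is proportional to
`φ ^ ∑ i, kendall (P i) W'`, because the normalization factor does not depend on the parameter
(`normFactor_eq`). Writing the Kendall distance as a sum over pairs, the exponent is, up to a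
constant, the total weight of the pairwise majorities that `W'` contradicts
(`sum_kendall_add_reversalCost`). Among the relations in which `c` beats everything, the cheapest
one agrees with every majority on the pairs that do not contain `c`, and its cost is `s(c, P)`.
When all majorities are larger than a constant `K`, this relation carries almost all the mass of
its class, so the posterior probability that `c` is on top is `φ ^ s(c, P)` up to a common constant
and a factor close to `1`. As `s` takes integer values, a strictly smaller `s` then means a strictly
larger probability (`topMass_lt`); if moreover no two values of `s` coincide, the only optimal
decision is the singleton of the minimizer of `s`, which is the choice of `g`
(`eq_ruleG_of_isMin`).

It remains to see that small majorities and ties of `s` have vanishing probability. The expected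
weights `w(a, b)` need not have the sign of `W`, and may even vanish, when votes are restricted to
`L(C)` and `W` has cycles, so no law of large numbers is used. Instead, `w(a, b)` and, once the
signs of the majorities are fixed, `s(c, P) - s(d, P)` are sums of independent copies of an integer
function of a vote. These functions take different values at two linear orders that differ by an
exchange of their first two alternatives, and both orders have positive probability. Hence the
characteristic function of one summand has modulus less than `1` outside a countable set of
frequencies, and by Fourier inversion and dominated convergence each fixed value of the sum has
vanishing probability (`tendsto_pi_sum_eq`). This argument covers votes in `L(C)` and in `B(C)`
at once.
-/

namespace SocialChoice

/-! ### Anti-concentration of integer random walks -/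

lemma integral_exp_int_mul_I (m : ℤ) :
    ∫ t in (0 : ℝ)..2 * Real.pi, Complex.exp (m * Complex.I * t) =
      if m = 0 then 2 * (Real.pi : ℂ) else 0 := by
  split_ifs with h
  · simp [h]
  · have hm : (m : ℂ) * Complex.I ≠ 0 := mul_ne_zero (by exact_mod_cast h) Complex.I_ne_zero
    rw [integral_exp_mul_complex hm]
    have : Complex.exp (m * Complex.I * ((2 * Real.pi : ℝ) : ℂ)) = 1 :=
      Complex.exp_eq_one_iff.2 ⟨m, by push_cast; ring⟩
    rw [this]
    simp

lemma countable_exp_int_mul_I_eq_one {m : ℤ} (hm : m ≠ 0) :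
    {t : ℝ | Complex.exp (m * Complex.I * t) = 1}.Countable := by
  refine (Set.countable_range fun k : ℤ => 2 * Real.pi * k / m).mono ?_
  intro t ht
  obtain ⟨k, hk⟩ := Complex.exp_eq_one_iff.1 ht
  refine ⟨k, ?_⟩
  have hm' : (m : ℝ) ≠ 0 := by exact_mod_cast hm
  have h : (m : ℂ) * t = k * (2 * Real.pi) := by
    apply mul_right_cancel₀ Complex.I_ne_zero
    linear_combination hk
  have h' : (m : ℝ) * t = k * (2 * Real.pi) := by exact_mod_cast h
  field_simp
  linarith

/-- Fourier inversion for the law of a sum of independent copies of an integer variable `ℓ`. -/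
lemma two_pi_mul_pi_real_sum_eq {V : Type*} [Fintype V] [MeasurableSpace V]
    [DiscreteMeasurableSpace V] (μ : Measure V) [IsProbabilityMeasure μ] (ℓ : V → ℤ) (k : ℤ)
    (n : ℕ) :
    2 * (Real.pi : ℂ) * ((Measure.pi fun _ : Fin n => μ).real {P | ∑ i, ℓ (P i) = k} : ℂ) =
      ∫ t in (0 : ℝ)..2 * Real.pi,
        (∑ v, μ.real {v} • Complex.exp (ℓ v * Complex.I * t)) ^ n *
          Complex.exp (-k * Complex.I * t) := by
  classical
  have hpt (P : Fin n → V) : (Measure.pi fun _ : Fin n => μ).real {P} = ∏ i, μ.real {P i} := by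
    simp [measureReal_def, Measure.pi_singleton, ENNReal.toReal_prod]
  have hexp (t : ℝ) : (∑ v, μ.real {v} • Complex.exp (ℓ v * Complex.I * t)) ^ n *
        Complex.exp (-k * Complex.I * t) =
      ∑ P : Fin n → V, ((∏ i, μ.real {P i} : ℝ) : ℂ) *
        Complex.exp (((∑ i, ℓ (P i) - k : ℤ) : ℂ) * Complex.I * t) := by
    have := Finset.prod_univ_sum (fun _ : Fin n => (Finset.univ : Finset V))
      (fun _ v => μ.real {v} • Complex.exp (ℓ v * Complex.I * t))
    rw [Finset.prod_const, Finset.card_univ, Fintype.card_fin, Fintype.piFinset_univ] at this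
    rw [this, Finset.sum_mul]
    refine Finset.sum_congr rfl fun P _ => ?_
    simp only [Complex.real_smul]
    rw [Finset.prod_mul_distrib, ← Complex.exp_sum, mul_assoc, ← Complex.exp_add]
    push_cast
    congr 2
    rw [← Finset.sum_mul, ← Finset.sum_mul]
    ring
  simp_rw [hexp]
  rw [intervalIntegral.integral_finsetSum]
  · simp_rw [intervalIntegral.integral_const_mul, integral_exp_int_mul_I]
    rw [← (Set.toFinite {P : Fin n → V | ∑ i, ℓ (P i) = k}).coe_toFinset,
      ← sum_measureReal_singleton]
    simp_rw [hpt, sub_eq_zero, mul_ite, mul_zero, ← Finset.sum_filter]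
    rw [← Finset.sum_mul, mul_comm]
    push_cast
    congr 2
    ext P
    simp
  · intro P _
    apply Continuous.intervalIntegrable
    fun_prop

/-- Independent copies of a non-constant integer variable: each value of their sum has
asymptotically vanishing probability, because the characteristic function has modulus less than
`1` outside a countable set. -/
theorem tendsto_pi_sum_eq {V : Type*} [Fintype V] [MeasurableSpace V]
    [DiscreteMeasurableSpace V] (μ : Measure V) [IsProbabilityMeasure μ] (ℓ : V → ℤ) {x y : V}
    (hx : μ {x} ≠ 0) (hy : μ {y} ≠ 0) (hxy : ℓ x ≠ ℓ y) (k : ℤ) :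
    Tendsto (fun n : ℕ => (Measure.pi fun _ : Fin n => μ) {P | ∑ i, ℓ (P i) = k})
      atTop (𝓝 0) := by
  have hsum : ∑ v, μ.real {v} = 1 := by simp [sum_measureReal_singleton]
  have hone (m : ℤ) (t : ℝ) : ‖Complex.exp (m * Complex.I * t)‖ = 1 := by
    rw [show (m : ℂ) * Complex.I * t = ((m * t : ℝ) : ℂ) * Complex.I by push_cast; ring]
    exact Complex.norm_exp_ofReal_mul_I _
  have hone' (t : ℝ) : ‖Complex.exp (-k * Complex.I * t)‖ = 1 := by
    simpa using hone (-k) t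
  have hle (t : ℝ) : ‖∑ v, μ.real {v} • Complex.exp (ℓ v * Complex.I * t)‖ ≤ 1 := by
    refine (norm_sum_le _ _).trans ?_
    simp [hone, abs_of_nonneg measureReal_nonneg, hsum]
  have hlt (t : ℝ) (ht : Complex.exp (((ℓ x - ℓ y : ℤ) : ℂ) * Complex.I * t) ≠ 1) :
      ‖∑ v, μ.real {v} • Complex.exp (ℓ v * Complex.I * t)‖ < 1 := by
    have hne : Complex.exp (ℓ x * Complex.I * t) ≠ Complex.exp (ℓ y * Complex.I * t) := by
      intro h
      apply ht
      rw [show ((ℓ x - ℓ y : ℤ) : ℂ) * Complex.I * t =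
        ℓ x * Complex.I * t - ℓ y * Complex.I * t by push_cast; ring, Complex.exp_sub, h,
        div_self (Complex.exp_ne_zero _)]
    have := (strictConvex_closedBall ℝ (0 : ℂ) 1).sum_mem_interior (t := Finset.univ)
      (w := fun v => μ.real {v}) (z := fun v => Complex.exp (ℓ v * Complex.I * t))
      (fun _ _ => measureReal_nonneg) hsum (Finset.mem_univ x) (Finset.mem_univ y) hne
      (by simpa [measureReal_def, ENNReal.toReal_eq_zero_iff] using hx)
      (by simpa [measureReal_def, ENNReal.toReal_eq_zero_iff] using hy)
      (fun v _ => by simp [hone])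
    rw [interior_closedBall _ one_ne_zero] at this
    simpa using this
  have hint : Tendsto (fun n : ℕ => ∫ t in (0 : ℝ)..2 * Real.pi,
      (∑ v, μ.real {v} • Complex.exp (ℓ v * Complex.I * t)) ^ n *
        Complex.exp (-k * Complex.I * t)) atTop (𝓝 (∫ _ in (0 : ℝ)..2 * Real.pi, 0)) := by
    refine intervalIntegral.tendsto_integral_filter_of_dominated_convergence (fun _ => 1)
      ?_ ?_ ?_ ?_
    · refine Eventually.of_forall fun n => Continuous.aestronglyMeasurable ?_
      fun_prop
    · refine Eventually.of_forall fun n => Eventually.of_forall fun t _ => ?_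
      rw [norm_mul, hone', mul_one, norm_pow]
      exact pow_le_one₀ (norm_nonneg _) (hle t)
    · exact intervalIntegrable_const
    · have hae := (countable_exp_int_mul_I_eq_one (sub_ne_zero.2 hxy)).ae_notMem volume
      filter_upwards [hae] with t ht _
      rw [tendsto_zero_iff_norm_tendsto_zero]
      simp_rw [norm_mul, hone', mul_one, norm_pow]
      exact tendsto_pow_atTop_nhds_zero_of_lt_one (norm_nonneg _) (hlt t ht)
  simp_rw [← two_pi_mul_pi_real_sum_eq, intervalIntegral.integral_zero] at hint
  have hpi : 2 * (Real.pi : ℂ) ≠ 0 := by exact_mod_cast Real.two_pi_pos.ne'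
  have hreal := (hint.const_mul (2 * (Real.pi : ℂ))⁻¹).norm
  simp_rw [inv_mul_cancel_left₀ hpi, mul_zero, norm_zero, Complex.norm_real,
    Real.norm_of_nonneg measureReal_nonneg] at hreal
  rw [← ENNReal.toReal_zero] at hreal
  exact (ENNReal.tendsto_toReal_iff (fun n => measure_ne_top _ _) ENNReal.zero_ne_top).1 hreal

/-! ### Kendall distance and pairwise majorities -/

open scoped Classical in
/-- The contribution of a single vote to the weight `w(a, b)`: it is `1`, `-1` or `0` according to
whether `V` prefers `a`, prefers `b`, or `a = b`. -/
noncomputable def pairSign {C : Type*} (a b : C) (V : BRel C) : ℤ :=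
  (if V.rel a b then 1 else 0) - (if V.rel b a then 1 else 0)

lemma BRel.not_rel_iff {C : Type*} (V : BRel C) {a b : C} (h : a ≠ b) :
    ¬ V.rel a b ↔ V.rel b a :=
  ⟨fun h' => (V.total a b h).resolve_left h', fun h' h'' => h (V.antisymm a b h'' h')⟩

lemma BRel.ne_of_rel {C : Type*} (V : BRel C) {a b : C} (h : V.rel a b) : a ≠ b := by
  rintro rfl
  exact V.irrefl a h

lemma BRel.eq_of_le {C : Type*} {V W : BRel C} (h : ∀ a b, V.rel a b → W.rel a b) : V = W := by
  ext a b
  refine ⟨h a b, fun hab => ?_⟩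
  by_contra hV
  exact (W.not_rel_iff (W.ne_of_rel hab).symm).2 hab
    (h b a ((V.not_rel_iff (W.ne_of_rel hab)).1 hV))

lemma wmg_eq_sum {C : Type*} {n : ℕ} (P : Profile C n) (a b : C) :
    wmg P a b = ∑ i, pairSign a b (P i) := by
  classical
  simp [wmg, pairSign, Set.ncard_eq_toFinset_card', Finset.sum_sub_distrib]

lemma wmg_swap {C : Type*} {n : ℕ} (P : Profile C n) (a b : C) :
    wmg P b a = -wmg P a b := by
  simp [wmg]

lemma wmg_self {C : Type*} {n : ℕ} (P : Profile C n) (a : C) : wmg P a a = 0 := by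
  simp [wmg]

open scoped Classical in
/-- The sum of `h` over the edges of a member of `B(C)` does not depend on the relation when `h` is
symmetric. -/
lemma two_mul_sum_edges {C : Type*} [Fintype C] (W : BRel C) (h : C → C → ℤ)
    (hh : ∀ a b, h a b = h b a) :
    2 * ∑ a, ∑ b, (if W.rel a b then h a b else 0) =
      ∑ a, ∑ b, if a = b then 0 else h a b := by
  have : ∑ a, ∑ b, (if W.rel a b then h a b else 0) =
      ∑ a, ∑ b, (if W.rel b a then h a b else 0) := by
    rw [Finset.sum_comm]
    simp_rw [hh]
  rw [two_mul]
  nth_rewrite 2 [this]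
  simp_rw [← Finset.sum_add_distrib]
  refine Finset.sum_congr rfl fun a _ => Finset.sum_congr rfl fun b _ => ?_
  rcases eq_or_ne a b with rfl | hab
  · simp [W.irrefl]
  · have := W.not_rel_iff hab
    by_cases h1 : W.rel a b <;> simp_all

open scoped Classical in
lemma two_mul_kendall {C : Type*} [Fintype C] (V W : BRel C) :
    2 * (kendall V W : ℤ) =
      ∑ a, ∑ b, if W.rel a b then 1 - pairSign a b V else 0 := by
  have : (kendall V W : ℤ) =
      ∑ a, ∑ b, if W.rel a b then (if V.rel b a then 1 else 0) else 0 := by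
    rw [kendall, Set.ncard_eq_toFinset_card', Finset.sum_comm, ← Fintype.sum_prod_type']
    simp_rw [← ite_and]
    simp [and_comm]
  rw [this, Finset.mul_sum]
  refine Finset.sum_congr rfl fun a _ => ?_
  rw [Finset.mul_sum]
  refine Finset.sum_congr rfl fun b _ => ?_
  split_ifs with h1 h2
  · have := (V.not_rel_iff (W.ne_of_rel h1)).2 h2
    simp [pairSign, h2, this]
  · have := (V.not_rel_iff (W.ne_of_rel h1).symm).1 h2
    simp [pairSign, h2, this]
  · simp

/-- The relation that orders a pair as `W` does or in the opposite way, according to whether `V`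
and `U` agree on the pair. For fixed `U` and `W` this is a symmetry of `B(C)` that takes `U`
to `W`. -/
def transport {C : Type*} (U W V : BRel C) : BRel C where
  rel a b := a ≠ b ∧ (W.rel a b ↔ (V.rel a b ↔ U.rel a b))
  irrefl a h := h.1 rfl
  antisymm a b h h' := by
    by_contra hab
    have h1 := W.not_rel_iff hab
    have h2 := U.not_rel_iff hab
    have h3 := V.not_rel_iff hab
    tauto
  total a b hab := by
    have h1 := W.not_rel_iff hab
    have h2 := U.not_rel_iff hab
    have h3 := V.not_rel_iff hab
    have := hab.symm
    tauto

lemma transport_involutive {C : Type*} (U W : BRel C) : Function.Involutive (transport U W) := by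
  intro V
  refine (BRel.eq_of_le fun a b h => ?_).symm
  have := V.ne_of_rel h
  simp only [transport]
  tauto

lemma kendall_transport {C : Type*} [Fintype C] (U W V : BRel C) :
    kendall (transport U W V) W = kendall V U := by
  classical
  have key (V' W' : BRel C) : 2 * (2 * (kendall V' W' : ℤ)) =
      ∑ a, ∑ b, if a = b then 0 else (if V'.rel a b ↔ W'.rel a b then 0 else 2) := by
    have hs (a b : C) : (if V'.rel a b ↔ W'.rel a b then (0 : ℤ) else 2) =
        if V'.rel b a ↔ W'.rel b a then 0 else 2 := by
      rcases eq_or_ne a b with rfl | hab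
      · rfl
      · simp_rw [← V'.not_rel_iff hab, ← W'.not_rel_iff hab, not_iff_not]
    rw [← two_mul_sum_edges W' _ hs, two_mul_kendall]
    congr 1
    refine Finset.sum_congr rfl fun a _ => Finset.sum_congr rfl fun b _ => ?_
    split_ifs with h1 h2
    · have h3 := h2.2 h1
      have := (V'.not_rel_iff (W'.ne_of_rel h1).symm).2 h3
      simp [pairSign, h3, this]
    · have h3 : ¬ V'.rel a b := by tauto
      have := (V'.not_rel_iff (W'.ne_of_rel h1)).1 h3
      simp [pairSign, h3, this]
    · rfl
  have h : (2 * (2 * (kendall (transport U W V) W : ℤ))) = 2 * (2 * (kendall V U : ℤ)) := by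
    rw [key, key]
    refine Finset.sum_congr rfl fun a _ => Finset.sum_congr rfl fun b _ => ?_
    by_cases hab : a = b
    · simp [hab]
    · simp only [transport]
      by_cases h1 : W.rel a b <;> by_cases h2 : V.rel a b <;> by_cases h3 : U.rel a b <;>
        simp [h1, h2, h3, hab]
  omega

lemma normFactor_eq {C : Type*} [Fintype C] (φ : ℝ) (U W : BRel C) :
    normFactor φ U = normFactor φ W := by
  exact Fintype.sum_equiv (transport_involutive U W).toPerm _ _ fun V => by
    simp [kendall_transport]

/-! ### The posterior distribution -/

open scoped Classical in
/-- The total weight of the pairwise majorities of `P` that `W` contradicts. -/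
noncomputable def reversalCost {C : Type*} [Fintype C] {n : ℕ} (P : Profile C n)
    (W : BRel C) : ℕ :=
  ∑ a, ∑ b, if W.rel a b then (wmg P b a).toNat else 0

/-- Up to a constant that does not depend on the parameter, the Kendall distance to the profile is
the weight of the contradicted majorities. -/
lemma sum_kendall_add_reversalCost {C : Type*} [Fintype C] {n : ℕ} (P : Profile C n)
    (U W : BRel C) :
    ∑ i, kendall (P i) U + reversalCost P W = ∑ i, kendall (P i) W + reversalCost P U := by
  classical
  have key (V : BRel C) : 2 * (2 * ((∑ i, kendall (P i) V : ℕ) : ℤ) - 2 * reversalCost P V) =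
      ∑ a, ∑ b, if a = b then 0 else (n - |wmg P a b|) := by
    rw [← two_mul_sum_edges V _ (fun a b => by rw [wmg_swap P a b, abs_neg])]
    congr 1
    push_cast
    rw [Finset.mul_sum]
    simp_rw [two_mul_kendall]
    rw [Finset.sum_comm, reversalCost]
    push_cast
    rw [Finset.mul_sum, ← Finset.sum_sub_distrib]
    refine Finset.sum_congr rfl fun a _ => ?_
    rw [Finset.sum_comm, Finset.mul_sum, ← Finset.sum_sub_distrib]
    refine Finset.sum_congr rfl fun b _ => ?_
    split_ifs with h
    · rw [Finset.sum_sub_distrib, ← wmg_eq_sum, wmg_swap P a b]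
      simp only [Finset.sum_const, Finset.card_univ, Fintype.card_fin, nsmul_eq_mul, mul_one]
      rcases le_total 0 (wmg P a b) with h0 | h0
      · rw [abs_of_nonneg h0]; omega
      · rw [abs_of_nonpos h0]; omega
    · simp
  have h1 := key U
  have h2 := key W
  omega

lemma normFactor_pos {C : Type*} [Fintype C] {φ : ℝ} (hφ : 0 < φ) (W : BRel C) :
    0 < normFactor φ W :=
  Finset.sum_pos (fun _ _ => pow_pos hφ _) ⟨W, Finset.mem_univ _⟩

lemma posterior_eq {C : Type*} [Fintype C] {φ : ℝ} (hφ : 0 < φ) {n : ℕ} (P : Profile C n)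
    (W : BRel C) :
    posterior φ P W =
      φ ^ reversalCost P W / ∑ W' : BRel C, φ ^ reversalCost P W' := by
  set u : ℝ := (1 / normFactor φ W) ^ n * φ ^ (∑ i, kendall (P i) W) / φ ^ reversalCost P W *
    (1 / (Fintype.card (BRel C) : ℝ)) with hu
  have hcard : (0 : ℝ) < Fintype.card (BRel C) := by
    exact_mod_cast Fintype.card_pos_iff.2 ⟨W⟩
  have hu0 : u ≠ 0 := by
    have := normFactor_pos hφ W
    positivity
  have h (W' : BRel C) : likelihood φ P W' * uniformPrior C W' = u * φ ^ reversalCost P W' := by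
    have hT := congrArg (φ ^ ·) (sum_kendall_add_reversalCost P W' W)
    simp only [pow_add] at hT
    rw [likelihood, uniformPrior, hu]
    simp only [voteProb]
    rw [Finset.prod_mul_distrib, Finset.prod_pow_eq_pow_sum, Finset.prod_const, Finset.card_univ,
      Fintype.card_fin, normFactor_eq φ W' W]
    have := hφ.ne'
    field_simp
    linear_combination (normFactor φ W)⁻¹ ^ n * hT
  rw [posterior]
  simp_rw [h]
  rw [← Finset.mul_sum, mul_div_mul_left _ _ hu0]

/-! ### The most probable top alternative -/

/-- `c` beats every other alternative in `W`. -/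
def IsTop {C : Type*} (W : BRel C) (c : C) : Prop := ∀ b, b ≠ c → W.rel c b

open scoped Classical in
/-- The unnormalized posterior probability that `c` beats every other alternative. -/
noncomputable def topMass {C : Type*} [Fintype C] (φ : ℝ) {n : ℕ} (P : Profile C n) (c : C) : ℝ :=
  ∑ W : BRel C with IsTop W c, φ ^ reversalCost P W

lemma inWeight_eq_sum {C : Type*} [Fintype C] {n : ℕ} (P : Profile C n) (c : C) :
    inWeight c P = ((∑ b, (wmg P b c).toNat : ℕ) : ℤ) := by
  rw [inWeight, Finset.sum_filter]
  push_cast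
  refine Finset.sum_congr rfl fun b _ => ?_
  split_ifs with h <;> omega

lemma inWeight_nonneg {C : Type*} [Fintype C] {n : ℕ} (P : Profile C n) (c : C) :
    0 ≤ inWeight c P := by
  rw [inWeight_eq_sum]; positivity

open scoped Classical in
lemma reversalCost_of_isTop {C : Type*} [Fintype C] {n : ℕ} (P : Profile C n) {W : BRel C} {c : C}
    (hW : IsTop W c) :
    reversalCost P W = (inWeight c P).toNat +
      ∑ a ∈ Finset.univ.erase c, ∑ b, if W.rel a b then (wmg P b a).toNat else 0 := by
  rw [reversalCost, ← Finset.add_sum_erase _ _ (Finset.mem_univ c), inWeight_eq_sum,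
    Int.toNat_natCast]
  congr 1
  refine Finset.sum_congr rfl fun b _ => ?_
  rcases eq_or_ne b c with rfl | hb
  · simp [W.irrefl, wmg_self]
  · simp [hW b hb]

/-- The pairwise majority relation of `P`, changed so that `c` beats every other alternative. -/
def majorityWithTop {C : Type*} {n : ℕ} (P : Profile C n)
    (hP : ∀ a b, a ≠ b → wmg P a b ≠ 0) (c : C) : BRel C where
  rel a b := a ≠ b ∧ (a = c ∨ (b ≠ c ∧ 0 < wmg P a b))
  irrefl a h := h.1 rfl
  antisymm a b h h' := by
    have := wmg_swap P a b
    by_contra hab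
    rcases h.2 with rfl | ⟨h1, h2⟩ <;> rcases h'.2 with rfl | ⟨h3, h4⟩ <;> first | tauto | omega
  total a b hab := by
    have h1 := wmg_swap P a b
    have h2 := hP a b hab
    have h3 := hab.symm
    rcases h2.lt_or_gt with h | h
    · have : 0 < wmg P b a := by omega
      tauto
    · tauto

lemma isTop_majorityWithTop {C : Type*} {n : ℕ} (P : Profile C n)
    (hP : ∀ a b, a ≠ b → wmg P a b ≠ 0) (c : C) : IsTop (majorityWithTop P hP c) c :=
  fun _ hb => ⟨hb.symm, Or.inl rfl⟩

section

variable {C : Type*} [Fintype C] {n : ℕ} (P : Profile C n)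

lemma reversalCost_majorityWithTop (hP : ∀ a b, a ≠ b → wmg P a b ≠ 0) (c : C) :
    reversalCost P (majorityWithTop P hP c) = (inWeight c P).toNat := by
  classical
  rw [reversalCost_of_isTop P (isTop_majorityWithTop P hP c), Nat.add_eq_left]
  refine Finset.sum_eq_zero fun a ha => Finset.sum_eq_zero fun b _ => ?_
  split_ifs with h
  · have h1 := (h.2.resolve_left (Finset.ne_of_mem_erase ha)).2
    have := wmg_swap P a b
    omega
  · rfl

/-- Among the relations with `c` on top, all but the cheapest contradict a further majority, of
weight more than `K`. -/
lemma add_le_reversalCost (hP : ∀ a b, a ≠ b → wmg P a b ≠ 0) {K : ℕ}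
    (hK : ∀ a b, a ≠ b → (K : ℤ) < |wmg P a b|) {W : BRel C} {c : C} (hW : IsTop W c)
    (hne : W ≠ majorityWithTop P hP c) :
    (inWeight c P).toNat + K ≤ reversalCost P W := by
  classical
  obtain ⟨a, b, hab, hab'⟩ : ∃ a b, W.rel a b ∧ ¬ (majorityWithTop P hP c).rel a b := by
    by_contra! h
    exact hne (BRel.eq_of_le h)
  have hne' := W.ne_of_rel hab
  have hbc : b ≠ c := by
    rintro rfl
    exact (W.not_rel_iff hne').2 (hW a hne') hab
  simp only [majorityWithTop, not_and, not_or, not_lt] at hab'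
  obtain ⟨hac, hw⟩ := hab' hne'
  rw [reversalCost_of_isTop P hW]
  have h1 : K ≤ (wmg P b a).toNat := by
    have h2 := hK a b hne'
    rw [abs_of_nonpos (hw hbc), ← wmg_swap] at h2
    omega
  refine Nat.add_le_add_left (h1.trans ?_) _
  calc (wmg P b a).toNat = if W.rel a b then (wmg P b a).toNat else 0 := by simp [hab]
    _ ≤ ∑ b, if W.rel a b then (wmg P b a).toNat else 0 :=
      Finset.single_le_sum (f := fun b => if W.rel a b then (wmg P b a).toNat else 0)
        (fun _ _ => Nat.zero_le _) (Finset.mem_univ b)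
    _ ≤ _ := Finset.single_le_sum
        (f := fun a => ∑ b, if W.rel a b then (wmg P b a).toNat else 0)
        (fun _ _ => Nat.zero_le _) (Finset.mem_erase.2 ⟨hac, Finset.mem_univ a⟩)

/-- When all majorities are large, the posterior probability that `c` is the top alternative is
governed by `s(c, P)`, since a single relation dominates the sum; larger `s` means smaller
probability. -/
lemma topMass_lt {φ : ℝ} (hφ0 : 0 < φ) (hφ1 : φ < 1) {K : ℕ}
    (hφK : φ * (1 + Fintype.card (BRel C) * φ ^ K) < 1)
    (hK : ∀ a b, a ≠ b → (K : ℤ) < |wmg P a b|) {c d : C} (hcd : inWeight c P < inWeight d P) :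
    topMass φ P d < topMass φ P c := by
  classical
  have hP : ∀ a b, a ≠ b → wmg P a b ≠ 0 := fun a b hab =>
    abs_pos.1 ((Int.natCast_nonneg K).trans_lt (hK a b hab))
  have hlow : φ ^ (inWeight c P).toNat ≤ topMass φ P c := by
    rw [← reversalCost_majorityWithTop P hP c]
    exact Finset.single_le_sum (f := fun W => φ ^ reversalCost P W) (fun _ _ => by positivity)
      (by simp [isTop_majorityWithTop])
  have hupp : topMass φ P d ≤
      φ ^ (inWeight d P).toNat * (1 + Fintype.card (BRel C) * φ ^ K) := by
    calc topMass φ P d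
        ≤ ∑ W : BRel C with IsTop W d,
          ((if W = majorityWithTop P hP d then φ ^ (inWeight d P).toNat else 0) +
            φ ^ ((inWeight d P).toNat + K)) := by
          refine Finset.sum_le_sum fun W hW => ?_
          have hp : 0 ≤ φ ^ ((inWeight d P).toNat + K) := by positivity
          split_ifs with h
          · rw [h, reversalCost_majorityWithTop]
            linarith
          · rw [zero_add]
            exact pow_le_pow_of_le_one hφ0.le hφ1.le
              (add_le_reversalCost P hP hK (Finset.mem_filter.1 hW).2 h)
      _ ≤ ∑ W : BRel C,
          ((if W = majorityWithTop P hP d then φ ^ (inWeight d P).toNat else 0) +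
            φ ^ ((inWeight d P).toNat + K)) :=
          Finset.sum_le_sum_of_subset_of_nonneg (Finset.filter_subset _ _)
            fun _ _ _ => by positivity
      _ = _ := by
          rw [Finset.sum_add_distrib, Finset.sum_ite_eq']
          simp [pow_add]
          ring
  have hs : (inWeight c P).toNat + 1 ≤ (inWeight d P).toNat := by
    have := inWeight_nonneg P c
    omega
  calc topMass φ P d ≤ φ ^ (inWeight d P).toNat * (1 + Fintype.card (BRel C) * φ ^ K) := hupp
    _ ≤ φ ^ ((inWeight c P).toNat + 1) * (1 + Fintype.card (BRel C) * φ ^ K) := by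
        gcongr ?_ * _
        exact pow_le_pow_of_le_one hφ0.le hφ1.le hs
    _ = φ ^ (inWeight c P).toNat * (φ * (1 + Fintype.card (BRel C) * φ ^ K)) := by ring
    _ < φ ^ (inWeight c P).toNat * 1 := by gcongr
    _ ≤ topMass φ P c := by simpa using hlow

/-! ### Minimizers of the Bayesian risk -/

lemma bayesRisk_eq (φ : ℝ) (D : Finset C) :
    bayesRisk φ P D = (∑ c ∈ D, ∑ W, posterior φ P W * lossTopAlt W c) / D.card := by
  simp_rw [bayesRisk, lossTop, mul_div_assoc', Finset.mul_sum]
  rw [← Finset.sum_div, Finset.sum_comm]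

lemma sum_posterior_mul_lossTopAlt {φ : ℝ} (hφ : 0 < φ) (c : C) :
    ∑ W, posterior φ P W * lossTopAlt W c =
      (∑ W, φ ^ reversalCost P W - topMass φ P c) / ∑ W, φ ^ reversalCost P W := by
  classical
  simp_rw [posterior_eq hφ, div_mul_eq_mul_div]
  rw [← Finset.sum_div, topMass, Finset.sum_filter, ← Finset.sum_sub_distrib]
  congr 1
  refine Finset.sum_congr rfl fun W _ => ?_
  have h : lossTopAlt W c = if IsTop W c then 0 else 1 := rfl
  rw [h]
  split_ifs <;> simp

/-- When all majorities are large and no two alternatives have the same `s`, the only nonempty set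
of minimum Bayesian risk is the one chosen by the rule `g`. -/
theorem eq_ruleG_of_isMin [Nonempty C] {φ : ℝ} (hφ0 : 0 < φ) (hφ1 : φ < 1) {K : ℕ}
    (hφK : φ * (1 + Fintype.card (BRel C) * φ ^ K) < 1)
    (hK : ∀ a b, a ≠ b → (K : ℤ) < |wmg P a b|)
    (hs : ∀ c d, c ≠ d → inWeight c P ≠ inWeight d P) {D : Finset C} (hD : D.Nonempty)
    (hmin : ∀ E : Finset C, E.Nonempty → bayesRisk φ P D ≤ bayesRisk φ P E) :
    D = ruleG P := by
  classical
  obtain ⟨c, hc⟩ := Finite.exists_min fun c => inWeight c P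
  have hlt (d : C) (hd : d ≠ c) : inWeight c P < inWeight d P := (hc d).lt_of_ne (hs c d hd.symm)
  have hrule : ruleG P = {c} := by
    ext d
    simp only [ruleG, Finset.mem_filter, Finset.mem_univ, true_and, Finset.mem_singleton]
    refine ⟨fun h => ?_, fun h => h ▸ hc⟩
    by_contra hd
    exact (hlt d hd).not_ge (h c)
  let r : C → ℝ := fun d => ∑ W, posterior φ P W * lossTopAlt W d
  have hr (d : C) (hd : d ≠ c) : r c < r d := by
    have hpos : 0 < ∑ W, φ ^ reversalCost P W :=
      Finset.sum_pos (fun _ _ => by positivity)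
        ⟨majorityWithTop P (fun a b hab =>
          abs_pos.1 ((Int.natCast_nonneg K).trans_lt (hK a b hab))) c, Finset.mem_univ _⟩
    simp only [r]
    rw [sum_posterior_mul_lossTopAlt P hφ0, sum_posterior_mul_lossTopAlt P hφ0]
    have := topMass_lt P hφ0 hφ1 hφK hK (hlt d hd)
    gcongr
  have hDc : D ⊆ {c} := by
    intro d hd
    rw [Finset.mem_singleton]
    by_contra hdc
    have h1 := hmin {c} (Finset.singleton_nonempty c)
    rw [bayesRisk_eq, bayesRisk_eq, Finset.sum_singleton, Finset.card_singleton, Nat.cast_one,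
      div_one, div_le_iff₀ (by exact_mod_cast hD.card_pos)] at h1
    have h2 : ∑ _e ∈ D, r c < ∑ e ∈ D, r e := by
      refine Finset.sum_lt_sum (fun e _ => ?_) ⟨d, hd, hr d hdc⟩
      rcases eq_or_ne e c with rfl | he
      · exact le_rfl
      · exact (hr e he).le
    rw [Finset.sum_const, nsmul_eq_mul, mul_comm] at h2
    exact h2.not_ge h1
  rw [hrule]
  exact (Finset.subset_singleton_iff.1 hDc).resolve_left hD.ne_empty

end

/-! ### Ties and small majorities are asymptotically negligible -/

open scoped Classical in
/-- The linear order that ranks `a` first, `b` second, and the other alternatives below them in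
some fixed order. -/
noncomputable def topTwo {C : Type*} [Fintype C] (a b : C) : BRel C :=
  let rank : C → ℕ := fun x =>
    if x = a then 0 else if x = b then 1 else (Fintype.equivFin C x : ℕ) + 2
  have hrank (x y : C) (h : rank x = rank y) : x = y := by
    simp only [rank] at h
    split_ifs at h <;> first
      | omega
      | exact (Fintype.equivFin C).injective (Fin.ext (by omega))
      | simp_all
  { rel := fun x y => rank x < rank y
    irrefl := fun _ => lt_irrefl _
    antisymm := fun _ _ h h' => (lt_asymm h h').elim
    total := fun x y h => lt_or_gt_of_ne fun h' => h (hrank x y h') }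

section

variable {C : Type*} [Fintype C]

lemma topTwo_mem_linearOrders (a b : C) : topTwo a b ∈ linearOrders C :=
  fun _ _ _ h h' => lt_trans (a := (_ : ℕ)) h h'

open scoped Classical in
lemma pairSign_topTwo_snd {c d : C} (hcd : c ≠ d) (b : C) :
    pairSign b c (topTwo d c) = if b = d then 1 else if b = c then 0 else -1 := by
  simp only [pairSign, topTwo]
  split_ifs <;> simp_all

open scoped Classical in
lemma pairSign_topTwo_fst (c d b : C) :
    pairSign b c (topTwo c d) = if b = c then 0 else -1 := by
  simp only [pairSign, topTwo]
  split_ifs <;> simp_all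

/-- The contribution of a single vote to `s(c, P) - s(d, P)`, when `A` and `B` are the sets of
alternatives that the majority prefers to `c` and to `d`. -/
noncomputable def tieForm (c d : C) (A B : Finset C) (V : BRel C) : ℤ :=
  ∑ b ∈ A, pairSign b c V - ∑ b ∈ B, pairSign b d V

lemma inWeight_sub_inWeight {n : ℕ} (P : Profile C n) (c d : C) :
    inWeight c P - inWeight d P = ∑ i, tieForm c d {b : C | 0 < wmg P b c}
      {b : C | 0 < wmg P b d} (P i) := by
  simp only [tieForm, inWeight, wmg_eq_sum, Finset.sum_sub_distrib]
  congr 1 <;> exact Finset.sum_comm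

/-- Exchanging `c` and `d` in adjacent positions affects only the pair `{c, d}`, and there the two
sums of `tieForm` cannot cancel. -/
lemma tieForm_topTwo_ne {c d : C} (hcd : c ≠ d) {A : Finset C} (hA : d ∈ A) (B : Finset C) :
    tieForm c d A B (topTwo d c) ≠ tieForm c d A B (topTwo c d) := by
  classical
  have h1 : ∑ b ∈ A, pairSign b c (topTwo c d) < ∑ b ∈ A, pairSign b c (topTwo d c) := by
    refine Finset.sum_lt_sum (fun b _ => ?_) ⟨d, hA, ?_⟩ <;>
      rw [pairSign_topTwo_snd hcd, pairSign_topTwo_fst]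
    · split_ifs <;> omega
    · simp [hcd.symm]
  have h2 : ∑ b ∈ B, pairSign b d (topTwo d c) ≤ ∑ b ∈ B, pairSign b d (topTwo c d) := by
    refine Finset.sum_le_sum fun b _ => ?_
    rw [pairSign_topTwo_snd hcd.symm, pairSign_topTwo_fst]
    split_ifs <;> omega
  simp only [tieForm]
  omega

lemma tendsto_measure_exists {ι : Type*} [Finite ι] {Ω : ℕ → Type*}
    [∀ n, MeasurableSpace (Ω n)] (μ : ∀ n, Measure (Ω n)) (E : ι → ∀ n, Set (Ω n))
    (h : ∀ j, Tendsto (fun n => μ n (E j n)) atTop (𝓝 0)) :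
    Tendsto (fun n => μ n {x | ∃ j, x ∈ E j n}) atTop (𝓝 0) := by
  have := Fintype.ofFinite ι
  have hs := tendsto_finsetSum Finset.univ fun j _ => h j
  rw [Finset.sum_const_zero] at hs
  refine tendsto_of_tendsto_of_tendsto_of_le_of_le tendsto_const_nhds hs (fun _ => zero_le) ?_
  intro n
  simp only [Set.ofPred_exists, Set.ofPred_mem_eq]
  exact measure_iUnion_fintype_le _ _

section

variable (μ : Measure (BRel C)) [IsProbabilityMeasure μ] (hμ : ∀ V ∈ linearOrders C, μ {V} ≠ 0)
include hμ

lemma tendsto_measure_small_majority (K : ℕ) :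
    Tendsto (fun n : ℕ => (Measure.pi fun _ : Fin n => μ)
      {P | ∃ a b, a ≠ b ∧ |wmg P a b| ≤ K}) atTop (𝓝 0) := by
  refine (tendsto_measure_exists (ι := {p : C × C // p.1 ≠ p.2} × Set.Icc (-(K : ℤ)) K)
    (fun n => Measure.pi fun _ : Fin n => μ)
    (fun j n => {P | ∑ i, pairSign j.1.1.1 j.1.1.2 (P i) = j.2}) ?_).congr fun n => ?_
  · rintro ⟨⟨⟨a, b⟩, hab⟩, k⟩
    refine tendsto_pi_sum_eq μ _ (hμ _ (topTwo_mem_linearOrders a b))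
      (hμ _ (topTwo_mem_linearOrders b a)) ?_ _
    classical
    change a ≠ b at hab
    simp [pairSign_topTwo_snd hab.symm, pairSign_topTwo_fst, hab]
  · congr 1
    ext P
    simp [← wmg_eq_sum, abs_le, and_left_comm]

lemma tendsto_measure_tie :
    Tendsto (fun n : ℕ => (Measure.pi fun _ : Fin n => μ)
      {P | ∃ c d, c ≠ d ∧ 0 < wmg P d c ∧ inWeight c P = inWeight d P}) atTop (𝓝 0) := by
  have h := tendsto_measure_exists
    (ι := {q : (C × C) × Finset C × Finset C // q.1.1 ≠ q.1.2 ∧ q.1.2 ∈ q.2.1})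
    (fun n => Measure.pi fun _ : Fin n => μ)
    (fun j n => {P | ∑ i, tieForm j.1.1.1 j.1.1.2 j.1.2.1 j.1.2.2 (P i) = 0}) fun j =>
      tendsto_pi_sum_eq μ _ (hμ _ (topTwo_mem_linearOrders _ _))
        (hμ _ (topTwo_mem_linearOrders _ _)) (tieForm_topTwo_ne j.2.1 j.2.2 _) _
  refine tendsto_of_tendsto_of_tendsto_of_le_of_le tendsto_const_nhds h (fun _ => zero_le)
    fun n => measure_mono ?_
  rintro P ⟨c, d, hcd, hw, hs⟩
  refine ⟨⟨((c, d), (({b : C | 0 < wmg P b c} : Finset C),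
    ({b : C | 0 < wmg P b d} : Finset C))), hcd, by simpa using hw⟩, ?_⟩
  change _ = _
  rw [← inWeight_sub_inWeight, hs, sub_self]

end

/-! ### The law of a vote -/

variable {φ : ℝ} (W : BRel C) {S : Set (BRel C)}

lemma condorcetMeasure_singleton_ne_zero (hφ : 0 < φ) (V : BRel C) :
    condorcetMeasure φ W {V} ≠ 0 := by
  have hv : 0 < voteProb φ W V := by
    have := normFactor_pos hφ W
    rw [voteProb]
    positivity
  rw [condorcetMeasure, Measure.finsetSum_apply, ← pos_iff_ne_zero]
  refine lt_of_lt_of_le ?_ (Finset.single_le_sum (fun _ _ => zero_le) (Finset.mem_univ V))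
  simpa using hv

instance (φ : ℝ) : IsFiniteMeasure (condorcetMeasure φ W) := by
  refine ⟨?_⟩
  rw [condorcetMeasure, Measure.finsetSum_apply]
  simp [ENNReal.sum_lt_top]

lemma voteLaw_singleton_ne_zero (hφ : 0 < φ) {V : BRel C} (hV : V ∈ S) :
    voteLaw φ W S {V} ≠ 0 := by
  rw [voteLaw, cond_apply (Set.toFinite S).measurableSet,
    Set.inter_eq_self_of_subset_right (Set.singleton_subset_iff.2 hV)]
  exact mul_ne_zero (ENNReal.inv_ne_zero.2 (measure_ne_top _ _))
    (condorcetMeasure_singleton_ne_zero W hφ V)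

lemma isProbabilityMeasure_voteLaw (hφ : 0 < φ) (hS : S.Nonempty) :
    IsProbabilityMeasure (voteLaw φ W S) := by
  obtain ⟨V, hV⟩ := hS
  refine cond_isProbabilityMeasure fun h => condorcetMeasure_singleton_ne_zero W hφ V ?_
  exact measure_mono_null (Set.singleton_subset_iff.2 hV) h

end

end SocialChoice

/-! ### Convergence of Bayesian estimators to `g` -/

theorem theorem8 {C : Type*} [Fintype C] [Nonempty C] (φ : ℝ) (hφ0 : 0 < φ) (hφ1 : φ < 1)
    (W : SocialChoice.BRel C) (S : Set (SocialChoice.BRel C))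
    (hS : S = SocialChoice.linearOrders C ∨ S = Set.univ)
    (f : (n : ℕ) → SocialChoice.Profile C n → Finset C)
    (hf : SocialChoice.IsBayesianEstimator φ S f) :
    Tendsto (fun n : ℕ => SocialChoice.profileLaw φ W S n
      {P : SocialChoice.Profile C n | f n P = SocialChoice.ruleG P}) atTop (𝓝 1) := by
  open SocialChoice in
  have hLS : linearOrders C ⊆ S := by
    rcases hS with rfl | rfl
    · exact subset_rfl
    · exact Set.subset_univ _
  have c₀ : C := Classical.arbitrary C
  have hprob : IsProbabilityMeasure (voteLaw φ W S) :=
    isProbabilityMeasure_voteLaw W hφ0 ⟨_, hLS (topTwo_mem_linearOrders c₀ c₀)⟩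
  have hpos : ∀ V ∈ linearOrders C, voteLaw φ W S {V} ≠ 0 := fun V hV =>
    voteLaw_singleton_ne_zero W hφ0 (hLS hV)
  -- `K` is so large that the relations other than the dominant one increase the mass of a class by
  -- a factor less than `1 / φ`, which is what a difference of one between two values of `s` gains.
  obtain ⟨K, hK⟩ : ∃ K : ℕ, φ * (1 + Fintype.card (BRel C) * φ ^ K) < 1 := by
    have h : Tendsto (fun K : ℕ => φ * (1 + Fintype.card (BRel C) * φ ^ K)) atTop
        (𝓝 (φ * (1 + Fintype.card (BRel C) * 0))) :=
      ((tendsto_pow_atTop_nhds_zero_of_lt_one hφ0.le hφ1).const_mul _).const_add _ |>.const_mul _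
    exact (h.eventually_lt_const (by simpa using hφ1)).exists
  have hbad := (tendsto_measure_small_majority (voteLaw φ W S) hpos K).add
    (tendsto_measure_tie (voteLaw φ W S) hpos)
  rw [add_zero] at hbad
  have hcompl : Tendsto (fun n : ℕ => profileLaw φ W S n {P | f n P = ruleG P}ᶜ) atTop (𝓝 0) := by
    refine tendsto_of_tendsto_of_tendsto_of_le_of_le tendsto_const_nhds hbad (fun _ => zero_le)
      fun n => le_trans (measure_mono_ae ?_) (measure_union_le _ _)
    have hmem : ∀ᵐ P : Profile C n ∂profileLaw φ W S n, ∀ i, P i ∈ S :=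
      ae_all_iff.2 fun i => (measurePreserving_eval (fun _ : Fin n => voteLaw φ W S) i
        ).quasiMeasurePreserving.ae (ae_cond_mem (Set.toFinite S).measurableSet)
    filter_upwards [hmem] with P hP hne
    by_contra hgood
    obtain ⟨h1, h2⟩ := not_or.1 hgood
    have hw : ∀ a b, a ≠ b → (K : ℤ) < |wmg P a b| := by
      intro a b hab
      by_contra! h
      exact h1 ⟨a, b, hab, h⟩
    refine hne (eq_ruleG_of_isMin P hφ0 hφ1 hK hw ?_ (hf n P hP).1 (hf n P hP).2)
    intro c d hcd hs
    have h0 : wmg P d c ≠ 0 := abs_pos.1 ((Int.natCast_nonneg K).trans_lt (hw d c hcd.symm))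
    -- The tie event records which of the two alternatives the majority prefers.
    rcases h0.lt_or_gt with h | h
    · exact h2 ⟨d, c, hcd.symm, by rw [wmg_swap P d c]; omega, hs.symm⟩
    · exact h2 ⟨c, d, hcd, h, hs⟩
  have hlaw (n : ℕ) : IsProbabilityMeasure (profileLaw φ W S n) := by
    unfold profileLaw
    infer_instance
  have hone := ENNReal.Tendsto.sub tendsto_const_nhds hcompl (Or.inl ENNReal.one_ne_top)
  rw [tsub_zero] at hone
  refine hone.congr fun n => ?_
  rw [← prob_compl_eq_one_sub (Set.toFinite _).measurableSet, compl_compl]
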